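/- Let $D=\sum_{n>0,\ (n,6)=1}x^{n^{2}}\in \mathbb{Z}/2[[x]]$, and let $T_5:\mathbb{Z}/2[[x]]\to \mathbb{Z}/2[[x]]$ be the formal Hecke operator $\sum_{n\ge 0} c_n x^n\mapsto \sum_{n\ge 0} c_{5n}x^n+\sum_{n\ge 0} c_n x^{5n}$. Let $W1$ and $W5$ be the $\mathbb{Z}/2$-subspaces of $\mathbb{Z}/2[[x]]$ spanned by the $D^k$ with $k>0$ and $k\equiv 1 \bmod 6$, respectively $k\equiv 5\bmod 6$. **Theorem 4.20.** For every integer $m\ge 0$, $T_5(D^{6m+5})$ is equal to $D^{6m+1}$ plus a (possibly empty) sum of powers $D^{6r+1}$ with $0\le r<m$. In particular, $T_5$ maps $W5$ into $W1$, and the map $T_5:W5\to W1$ is one-to-one and onto. -/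

import Mathlib

open PowerSeries

noncomputable section

/-- The formal Hecke operator `T_p` on `Z/2[[x]]`, for `p` an odd prime: it takes
`∑ c_n x^n` to `∑ c_{pn} x^n + ∑ c_n x^{pn}`. -/
def heckeT (p : ℕ) : (ZMod 2)⟦X⟧ →ₗ[ZMod 2] (ZMod 2)⟦X⟧ where
  toFun f := PowerSeries.mk fun n =>
    coeff (p * n) f + if p ∣ n then coeff (n / p) f else 0
  map_add' f g := by
    ext n
    simp only [coeff_mk, map_add]
    split_ifs <;> ring
  map_smul' a f := by
    ext n
    simp [mul_add]

open Classical in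
/-- `D = ∑ x^(n^2)` in `Z/2[[x]]`, the sum over the `n > 0` prime to `6`. -/
def seriesD : (ZMod 2)⟦X⟧ :=
  PowerSeries.mk fun N => if ∃ n : ℕ, 0 < n ∧ n.Coprime 6 ∧ N = n ^ 2 then 1 else 0

/-- The space `W1`: the span of the `D^k`, `k ≡ 1 mod 6`, `k > 0`. -/
def spaceW1 : Submodule (ZMod 2) (ZMod 2)⟦X⟧ :=
  Submodule.span (ZMod 2) {f | ∃ k : ℕ, 0 < k ∧ k ≡ 1 [MOD 6] ∧ f = seriesD ^ k}

/-- The space `W5`: the span of the `D^k`, `k ≡ 5 mod 6`, `k > 0`. -/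
def spaceW5 : Submodule (ZMod 2) (ZMod 2)⟦X⟧ :=
  Submodule.span (ZMod 2) {f | ∃ k : ℕ, 0 < k ∧ k ≡ 5 [MOD 6] ∧ f = seriesD ^ k}

end

noncomputable section

/-! Write `E = D(x^5)` and let `F` be the sum of `x^(n^2)` over odd `n > 0`. Everything rests on the
modular equation `D^6 = E D + E^6`. Modulo 2, `D^2 = D(x^2)`, so `D^3 = D(x) D(x^2)` counts
representations by `a^2 + 2b^2`, and `D E` counts those by `a^2 + 5b^2`. A reflection of each form
pairs off all representations except those on its axes, giving `D^3 = F(x^3)` and `D E = F(x^6) +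
F(x^30) = D^6 + E^6` (`seriesD_modular_equation`).

The equation is symmetric in `D` and `E`, so both halves of `T_5` satisfy one recurrence,
`T_5(D^(k+6)) = D T_5(D^(k+1)) + D^6 T_5(D^k)` (`heckeT_seriesD_pow_add_six`). With `T_5(D^k) = 0`
for `k < 5` and `T_5(D^5) = D`, induction gives the leading term `D^(6m+1)` of `T_5(D^(6m+5))`. Thus
`T_5 : W5 → W1` is unitriangular in the bases of powers of `D`, hence bijective. -/

/-! ### Parity of representation numbers by reflections -/

theorem natCast_card_eq_card_fixed {α : Type*} [DecidableEq α] (s : Finset α) (g : α → α)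
    (hs : ∀ a ∈ s, g a ∈ s) (hg : ∀ a ∈ s, g (g a) = a) :
    (s.card : ZMod 2) = ((s.filter fun a => g a = a).card : ZMod 2) := by
  rw [← Finset.card_filter_add_card_filter_not (s := s) (fun a => g a = a)]
  have : ((s.filter fun a => ¬ g a = a).card : ZMod 2) = 0 := by
    rw [Finset.cast_card]
    refine Finset.sum_involution (fun a _ => g a) ?_ ?_ ?_ ?_
    · intro a _
      decide
    · intro a ha _
      exact (Finset.mem_filter.1 ha).2
    · intro a ha
      rw [Finset.mem_filter] at ha ⊢
      refine ⟨hs a ha.1, fun h => ha.2 ?_⟩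
      rw [hg a ha.1] at h
      exact h.symm
    · intro a ha
      exact hg a (Finset.mem_filter.1 ha).1
  push_cast
  rw [this, add_zero]

/-- The representations `N = a ^ 2 + p * b ^ 2` by odd integers `a > 0` and `b` with
`a ≡ b mod 3`. -/
def oddReps (p N : ℤ) : Finset (ℤ × ℤ) :=
  (Finset.Icc 1 N ×ˢ Finset.Icc (-N) N).filter fun z =>
    Odd z.1 ∧ Odd z.2 ∧ 3 ∣ z.1 - z.2 ∧ z.1 ^ 2 + p * z.2 ^ 2 = N

theorem mem_oddReps {p N : ℤ} (hp : 0 < p) {z : ℤ × ℤ} :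
    z ∈ oddReps p N ↔
      0 < z.1 ∧ Odd z.1 ∧ Odd z.2 ∧ 3 ∣ z.1 - z.2 ∧ z.1 ^ 2 + p * z.2 ^ 2 = N := by
  simp only [oddReps, Finset.mem_filter, Finset.mem_product, Finset.mem_Icc]
  refine ⟨fun h => ⟨by linarith [h.1.1.1], h.2⟩, fun h => ⟨⟨⟨by linarith [h.1], ?_⟩, ?_⟩, h.2⟩⟩
  · nlinarith [h.2.2.2.2, sq_nonneg z.2, h.1]
  · rw [← abs_le]
    have h1 := Int.le_self_sq |z.2|
    rw [sq_abs] at h1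
    nlinarith [h.2.2.2.2, sq_nonneg z.2, h.1]

/-- If `3 ∣ a` then `3 ∣ b`, so `(a, b)` and `(a, -b)` both occur and cancel; they differ because
`b` is odd. Multiples of 3 are admitted because the reflections below need not preserve primality to
3. -/
theorem natCast_card_oddReps_not_three_dvd {p N : ℤ} (hp : 0 < p) :
    ((oddReps p N).card : ZMod 2) = (((oddReps p N).filter fun z => ¬ 3 ∣ z.1).card : ZMod 2) := by
  rw [natCast_card_eq_card_fixed (oddReps p N)
    (fun z => if 3 ∣ z.1 then (z.1, -z.2) else z)]
  · congr 2
    ext z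
    simp only [Finset.mem_filter, and_congr_right_iff]
    intro hz
    obtain ⟨-, -, h2, -⟩ := (mem_oddReps hp).1 hz
    split_ifs with h
    · simp only [h, not_true, iff_false]
      intro h'
      have := congrArg Prod.snd h'
      simp only at this
      obtain ⟨k, hk⟩ := h2
      omega
    · simp [h]
  · intro z hz
    split_ifs with h
    · rw [mem_oddReps hp] at hz ⊢
      obtain ⟨h0, h1, h2, h3, h4⟩ := hz
      refine ⟨h0, h1, h2.neg, ?_, by simpa using h4⟩
      omega
    · exact hz
  · intro z _
    by_cases h : 3 ∣ z.1 <;> simp [h]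

/-- A reflection preserving the congruences and the quadratic form that define `oddReps`
determines the parity of the number of representations. -/
theorem natCast_card_oddReps_eq_fixed {p N : ℤ} (hp : 0 < p) (s : ℤ × ℤ → ℤ × ℤ)
    (hneg : ∀ z : ℤ × ℤ, 3 ∣ z.1 - z.2 → s (-z) = -s z)
    (hinv : ∀ z : ℤ × ℤ, 3 ∣ z.1 - z.2 → s (s z) = z)
    (hodd : ∀ z : ℤ × ℤ, Odd z.1 → Odd z.2 → 3 ∣ z.1 - z.2 → Odd (s z).1 ∧ Odd (s z).2)
    (hthree : ∀ z : ℤ × ℤ, 3 ∣ z.1 - z.2 → 3 ∣ (s z).1 - (s z).2)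
    (hform : ∀ z : ℤ × ℤ, 3 ∣ z.1 - z.2 →
      (s z).1 ^ 2 + p * (s z).2 ^ 2 = z.1 ^ 2 + p * z.2 ^ 2) :
    ((oddReps p N).card : ZMod 2) =
      (((oddReps p N).filter fun z => s z = z ∨ s z = -z).card : ZMod 2) := by
  -- Of `s z` and `-s z`, exactly one has positive first coordinate; choosing it makes `s` an
  -- involution of `oddReps`.
  rw [natCast_card_eq_card_fixed (oddReps p N) (fun z => if 0 < (s z).1 then s z else -s z)]
  · congr 2
    ext z
    simp only [Finset.mem_filter, and_congr_right_iff]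
    intro hz
    obtain ⟨h0, -⟩ := (mem_oddReps hp).1 hz
    split_ifs with h
    · refine ⟨Or.inl, fun h' => h'.resolve_right fun h' => ?_⟩
      rw [h'] at h
      simp at h
      omega
    · rw [neg_eq_iff_eq_neg]
      refine ⟨Or.inr, fun h' => h'.resolve_left fun h' => ?_⟩
      rw [h'] at h
      exact h h0
  · intro z hz
    rw [mem_oddReps hp] at hz
    obtain ⟨h0, h1, h2, h3, h4⟩ := hz
    obtain ⟨h5, h6⟩ := hodd z h1 h2 h3
    have h7 := hthree z h3
    have h8 := hform z h3
    split_ifs with h <;> rw [mem_oddReps hp]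
    · exact ⟨h, h5, h6, h7, h8.trans h4⟩
    · refine ⟨?_, h5.neg, h6.neg, ?_, ?_⟩
      · obtain ⟨k, hk⟩ := h5
        simp only [Prod.fst_neg]
        omega
      · simp only [Prod.fst_neg, Prod.snd_neg]
        omega
      · simp only [Prod.fst_neg, Prod.snd_neg, neg_sq]
        exact h8.trans h4
  · intro z hz
    obtain ⟨h0, h1, h2, h3, h4⟩ := (mem_oddReps hp).1 hz
    by_cases h : 0 < (s z).1
    · simp only [h, if_true, hinv z h3, h0]
    · simp only [h, if_false, hneg _ (hthree z h3), hinv z h3, neg_neg, Prod.fst_neg]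
      rw [if_neg (by omega)]

theorem natCast_card_oddReps_two (N : ℤ) :
    ((oddReps 2 N).card : ZMod 2) =
      (((oddReps 2 N).filter fun z => z.1 = z.2).card : ZMod 2) := by
  -- The reflection with axes `a = b` (fixed) and `a = -2b` (negated); parity rules out the second
  -- axis.
  rw [natCast_card_oddReps_eq_fixed (by norm_num)
    (fun z => ((4 * z.2 - z.1) / 3, (2 * z.1 + z.2) / 3))]
  · congr 2
    ext z
    simp only [Finset.mem_filter, and_congr_right_iff, Prod.ext_iff, Prod.fst_neg, Prod.snd_neg]
    intro hz
    obtain ⟨h0, ⟨k, hk⟩, ⟨l, hl⟩, h3, h4⟩ := (mem_oddReps (by norm_num)).1 hz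
    omega
  · intro z hz
    simp only [Prod.ext_iff, Prod.fst_neg, Prod.snd_neg]
    omega
  · intro z hz
    simp only [Prod.ext_iff]
    omega
  · rintro z ⟨k, hk⟩ ⟨l, hl⟩ hz
    simp only [Int.odd_iff]
    omega
  · intro z hz
    simp only
    omega
  · rintro ⟨a, b⟩ ⟨k, hk⟩
    obtain rfl : a = b + 3 * k := by simp only at hk; omega
    have h1 : (4 * b - (b + 3 * k)) / 3 = b - k := by omega
    have h2 : (2 * (b + 3 * k) + b) / 3 = b + 2 * k := by omega
    simp only [h1, h2]
    ring

theorem natCast_card_oddReps_five (N : ℤ) :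
    ((oddReps 5 N).card : ZMod 2) =
      (((oddReps 5 N).filter fun z => z.1 = z.2 ∨ z.1 = -5 * z.2).card : ZMod 2) := by
  -- The reflection with axes `a = b` (fixed) and `a = -5b` (negated); both contain odd points.
  rw [natCast_card_oddReps_eq_fixed (by norm_num)
    (fun z => ((5 * z.2 - 2 * z.1) / 3, (z.1 + 2 * z.2) / 3))]
  · congr 2
    ext z
    simp only [Finset.mem_filter, and_congr_right_iff, Prod.ext_iff, Prod.fst_neg, Prod.snd_neg]
    intro hz
    obtain ⟨h0, ⟨k, hk⟩, ⟨l, hl⟩, h3, h4⟩ := (mem_oddReps (by norm_num)).1 hz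
    omega
  · intro z hz
    simp only [Prod.ext_iff, Prod.fst_neg, Prod.snd_neg]
    omega
  · intro z hz
    simp only [Prod.ext_iff]
    omega
  · rintro z ⟨k, hk⟩ ⟨l, hl⟩ hz
    simp only [Int.odd_iff]
    omega
  · intro z hz
    simp only
    omega
  · rintro ⟨a, b⟩ ⟨k, hk⟩
    obtain rfl : a = b + 3 * k := by simp only at hk; omega
    have h1 : (5 * b - 2 * (b + 3 * k)) / 3 = b - 2 * k := by omega
    have h2 : ((b + 3 * k) + 2 * b) / 3 = b + k := by omega
    simp only [h1, h2]
    ring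

/-! ### The modular equation -/

open Classical in
/-- The sum of the `x ^ (n ^ 2)` over the natural numbers `n` satisfying `P`, mod `2`. -/
def squareSeries (P : ℕ → Prop) : (ZMod 2)⟦X⟧ :=
  PowerSeries.mk fun N => if ∃ n : ℕ, P n ∧ N = n ^ 2 then 1 else 0

open Classical in
theorem seriesD_eq_squareSeries : seriesD = squareSeries fun n => 0 < n ∧ n.Coprime 6 := by
  ext N
  rw [seriesD, squareSeries, coeff_mk, coeff_mk]
  exact if_congr (by simp only [and_assoc]) rfl rfl

open Classical in
theorem coeff_squareSeries (P : ℕ → Prop) (j : ℕ) :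
    coeff j (squareSeries P) = if ∃ n : ℕ, P n ∧ j = n ^ 2 then 1 else 0 :=
  coeff_mk _ _

open Classical in
theorem coeff_expand_squareSeries (P : ℕ → Prop) {p : ℕ} (hp : p ≠ 0) (j : ℕ) :
    coeff j (expand p hp (squareSeries P)) =
      if ∃ n : ℕ, P n ∧ j = p * n ^ 2 then 1 else 0 := by
  rw [coeff_expand, coeff_squareSeries, ← ite_and]
  congr 1
  rw [eq_iff_iff]
  constructor
  · rintro ⟨⟨q, rfl⟩, m, h0, h2⟩
    rw [Nat.mul_div_cancel_left _ (Nat.pos_of_ne_zero hp)] at h2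
    exact ⟨m, h0, by rw [h2]⟩
  · rintro ⟨m, h0, rfl⟩
    exact ⟨dvd_mul_right _ _, m, h0, Nat.mul_div_cancel_left _ (Nat.pos_of_ne_zero hp)⟩

theorem coprime_six_iff (n : ℕ) : n.Coprime 6 ↔ n % 2 = 1 ∧ n % 3 ≠ 0 := by
  rw [show 6 = 2 * 3 from rfl, Nat.coprime_mul_iff_right, Nat.coprime_two_right,
    Nat.coprime_comm, Nat.Prime.coprime_iff_not_dvd Nat.prime_three, Nat.odd_iff,
    Nat.dvd_iff_mod_eq_zero]

/-- For positive `a`, `b` prime to 6, exactly one of `b`, `-b` is congruent to `a` mod 3, so the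
signed pairs in `oddReps` with `a` prime to 3 match the terms of the product. -/
theorem coeff_seriesD_mul_expand {p : ℕ} (hp : p ≠ 0) (N : ℕ) :
    coeff N (seriesD * expand p hp seriesD) = ((oddReps p N).card : ZMod 2) := by
  classical
  have hp' : (0 : ℤ) < p := by exact_mod_cast Nat.pos_of_ne_zero hp
  rw [natCast_card_oddReps_not_three_dvd hp', coeff_mul]
  simp only [seriesD_eq_squareSeries, coeff_squareSeries, coeff_expand_squareSeries, ← ite_and,
    mul_ite, mul_one, mul_zero]
  rw [Finset.sum_boole]
  congr 1
  symm
  refine Finset.card_bij (fun z _ => (z.1.natAbs ^ 2, p * z.2.natAbs ^ 2)) ?_ ?_ ?_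
  · intro z hz
    obtain ⟨hz, h5⟩ := Finset.mem_filter.1 hz
    obtain ⟨h0, ⟨k, hk⟩, ⟨l, hl⟩, h3, h4⟩ := (mem_oddReps hp').1 hz
    rw [Finset.mem_filter, Finset.HasAntidiagonal.mem_antidiagonal]
    simp only [coprime_six_iff]
    refine ⟨?_, ⟨_, ?_, rfl⟩, ⟨_, ?_, rfl⟩⟩
    · zify
      simpa using h4
    · omega
    · omega
  · intro z hz w hw h
    obtain ⟨hz, h5⟩ := Finset.mem_filter.1 hz
    obtain ⟨hw, h6⟩ := Finset.mem_filter.1 hw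
    obtain ⟨h0, -, -, h3, -⟩ := (mem_oddReps hp').1 hz
    obtain ⟨h0', -, -, h3', -⟩ := (mem_oddReps hp').1 hw
    simp only [Prod.mk.injEq, mul_eq_mul_left_iff, hp, or_false] at h
    have h1 := Nat.pow_left_injective two_ne_zero h.1
    have h2 := Nat.pow_left_injective two_ne_zero h.2
    rw [Prod.ext_iff]
    omega
  · rintro ⟨i, j⟩ hij
    rw [Finset.mem_filter, Finset.HasAntidiagonal.mem_antidiagonal] at hij
    simp only at hij
    obtain ⟨hN, ⟨b, ⟨hb, hb6⟩, rfl⟩, a, ⟨ha, ha6⟩, rfl⟩ := hij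
    rw [coprime_six_iff] at ha6 hb6
    zify at hN
    by_cases h : (3 : ℤ) ∣ a - b
    · refine ⟨(a, b), ?_, by simp⟩
      rw [Finset.mem_filter, mem_oddReps hp']
      simp only [Int.odd_iff]
      refine ⟨⟨?_, ?_, ?_, ?_, hN⟩, ?_⟩ <;> omega
    · have h' : (3 : ℤ) ∣ a - -b := by
        have h1 : a % 3 = 1 ∨ a % 3 = 2 := by omega
        have h2 : b % 3 = 1 ∨ b % 3 = 2 := by omega
        rcases h1 with h1 | h1 <;> rcases h2 with h2 | h2 <;> omega
      refine ⟨(a, -b), ?_, by simp⟩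
      rw [Finset.mem_filter, mem_oddReps hp']
      simp only [Int.odd_iff, neg_sq]
      refine ⟨⟨?_, ?_, ?_, ?_, hN⟩, ?_⟩ <;> omega

-- The points on the line are `(u n, v n)` with `n > 0` odd, and `N` determines `n`.
open Classical in
theorem card_oddReps_filter_line {p u v : ℤ} (hp : 0 < p) (hu : 0 < u) (hu' : Odd u)
    (hv : v = 1 ∨ v = -1) (huv : 3 ∣ u - v) (N : ℤ) :
    ((oddReps p N).filter fun z => z.1 = u * v * z.2).card =
      if ∃ n : ℕ, Odd n ∧ N = (u ^ 2 + p) * n ^ 2 then 1 else 0 := by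
  have hv2 : v * v = 1 := by rcases hv with rfl | rfl <;> rfl
  have hv' : Odd v := by rcases hv with rfl | rfl <;> decide
  split_ifs with h
  · obtain ⟨n, hn, rfl⟩ := h
    rw [Finset.card_eq_one]
    refine ⟨(u * n, v * n), ?_⟩
    ext ⟨a, b⟩
    rw [Finset.mem_filter, mem_oddReps hp, Finset.mem_singleton, Prod.mk.injEq]
    simp only
    constructor
    · rintro ⟨⟨h0, -, -, -, h4⟩, rfl⟩
      have h5 : (v * b) ^ 2 = (n : ℤ) ^ 2 := by
        have : (u ^ 2 + p) * (v * b) ^ 2 = (u ^ 2 + p) * (n : ℤ) ^ 2 := by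
          linear_combination h4 + p * b ^ 2 * hv2
        exact mul_left_cancel₀ (by positivity) this
      have h6 : 0 < v * b := by
        rw [mul_assoc] at h0
        exact pos_of_mul_pos_right h0 hu.le
      have h7 : v * b = n := (sq_eq_sq₀ h6.le (by positivity)).1 h5
      exact ⟨by rw [mul_assoc, h7], by linear_combination v * h7 - b * hv2⟩
    · rintro ⟨rfl, rfl⟩
      have hn0 : (0 : ℤ) < n := by exact_mod_cast hn.pos
      have hn' : Odd (n : ℤ) := by exact_mod_cast hn
      refine ⟨⟨by positivity, hu'.mul hn', hv'.mul hn', ?_, ?_⟩, ?_⟩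
      · rw [← sub_mul]
        exact huv.mul_right _
      · linear_combination p * n ^ 2 * hv2
      · linear_combination -u * n * hv2
  · rw [Finset.card_eq_zero, Finset.filter_eq_empty_iff]
    rintro ⟨a, b⟩ hz hab
    obtain ⟨h0, -, h2, h3, h4⟩ := (mem_oddReps hp).1 hz
    simp only at hab h4 h2
    refine h ⟨b.natAbs, Int.natAbs_odd.2 h2, ?_⟩
    rw [Int.natCast_natAbs, sq_abs, ← h4, hab]
    linear_combination u ^ 2 * b ^ 2 * (hv2 * (v * v + 1) - hv2 * v * v)

theorem seriesD_mul_expand_two :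
    seriesD * expand 2 two_ne_zero seriesD = expand 3 three_ne_zero (squareSeries Odd) := by
  classical
  ext N
  rw [coeff_seriesD_mul_expand, coeff_expand_squareSeries, Nat.cast_ofNat,
    natCast_card_oddReps_two]
  have := card_oddReps_filter_line (p := 2) (u := 1) (v := 1) (by norm_num) one_pos odd_one
    (Or.inl rfl) (by norm_num) N
  norm_num at this
  rw [this]
  norm_cast

theorem seriesD_mul_expand_five :
    seriesD * expand 5 (by norm_num) seriesD =
      expand 6 (by norm_num) (squareSeries Odd) + expand 30 (by norm_num) (squareSeries Odd) := by
  classical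
  ext N
  rw [coeff_seriesD_mul_expand, map_add, coeff_expand_squareSeries, coeff_expand_squareSeries,
    Nat.cast_ofNat, natCast_card_oddReps_five, Finset.filter_or, Finset.card_union_of_disjoint]
  · have h1 := card_oddReps_filter_line (p := 5) (u := 1) (v := 1) (by norm_num) one_pos odd_one
      (Or.inl rfl) (by norm_num) N
    have h2 := card_oddReps_filter_line (p := 5) (u := 5) (v := -1) (by norm_num) (by norm_num)
      (by decide) (Or.inr rfl) (by norm_num) N
    norm_num at h1 h2
    simp only [neg_mul]
    rw [h1, h2]
    norm_cast
  · rw [Finset.disjoint_filter]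
    intro z hz h h'
    obtain ⟨h0, -⟩ := (mem_oddReps (by norm_num)).1 hz
    omega

theorem powerSeries_add_self (f : (ZMod 2)⟦X⟧) : f + f = 0 := by
  ext n
  exact CharTwo.add_self_eq_zero _

theorem sq_eq_expand_two (f : (ZMod 2)⟦X⟧) : f ^ 2 = expand 2 two_ne_zero f := by
  have h : (expand 2 two_ne_zero f).map (frobenius (ZMod 2) 2) = f ^ 2 :=
    MvPowerSeries.map_frobenius_expand 2 two_ne_zero
  rw [← h, ZMod.frobenius_zmod]
  simp

/-- The modular equation relating `D` and `D(x ^ 5)`. -/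
theorem seriesD_modular_equation :
    seriesD ^ 6 = expand 5 (by norm_num) seriesD * seriesD +
      expand 5 (by norm_num) seriesD ^ 6 := by
  have h3 : seriesD ^ 3 = expand 3 three_ne_zero (squareSeries Odd) := by
    rw [← seriesD_mul_expand_two, ← sq_eq_expand_two]
    ring
  have h6 : seriesD ^ 6 = expand 6 (by norm_num) (squareSeries Odd) := by
    rw [show seriesD ^ 6 = (seriesD ^ 3) ^ 2 by ring, h3, sq_eq_expand_two, ← expand_mul]
  have h30 : expand 5 (by norm_num) seriesD ^ 6 = expand 30 (by norm_num) (squareSeries Odd) := by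
    rw [← map_pow, h6, ← expand_mul]
  rw [mul_comm, seriesD_mul_expand_five, h6, h30, add_assoc, powerSeries_add_self, add_zero]

/-! ### The Hecke operator and its recurrence -/

/-- The operator `∑ c_n x^n ↦ ∑ c_{pn} x^n`. -/
def contractSeries (p : ℕ) (f : (ZMod 2)⟦X⟧) : (ZMod 2)⟦X⟧ :=
  PowerSeries.mk fun n => coeff (p * n) f

theorem heckeT_eq {p : ℕ} (hp : p ≠ 0) (f : (ZMod 2)⟦X⟧) :
    heckeT p f = contractSeries p f + expand p hp f := by
  ext n
  simp only [heckeT, LinearMap.coe_mk, AddHom.coe_mk, contractSeries, map_add, coeff_expand, coeff_mk]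

theorem contractSeries_expand_mul {p : ℕ} (hp : p ≠ 0) (f g : (ZMod 2)⟦X⟧) :
    contractSeries p (expand p hp g * f) = g * contractSeries p f := by
  ext n
  rw [contractSeries, coeff_mk, coeff_mul, coeff_mul]
  symm
  refine Finset.sum_of_injOn (fun z => (p * z.1, p * z.2)) ?_ ?_ ?_ ?_
  · rintro z - w - h
    simpa [hp, Prod.ext_iff] using h
  · intro z hz
    simp only [Finset.mem_coe, Finset.HasAntidiagonal.mem_antidiagonal] at hz ⊢
    rw [← hz, mul_add]
  · rintro ⟨i, j⟩ hz hz'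
    rw [Finset.HasAntidiagonal.mem_antidiagonal] at hz
    simp only at hz
    by_cases h : p ∣ i
    · obtain ⟨a, rfl⟩ := h
      obtain ⟨b, rfl⟩ : p ∣ j := (Nat.dvd_add_right (dvd_mul_right p a)).1 (hz ▸ dvd_mul_right p n)
      refine absurd ⟨(a, b), ?_, rfl⟩ hz'
      rw [← mul_add] at hz
      simpa using Nat.eq_of_mul_eq_mul_left (Nat.pos_of_ne_zero hp) hz
    · simp only [coeff_expand_of_not_dvd p hp g h, zero_mul]
  · rintro z -
    simp [contractSeries]

theorem contractSeries_add (p : ℕ) (f g : (ZMod 2)⟦X⟧) :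
    contractSeries p (f + g) = contractSeries p f + contractSeries p g := by
  ext n
  simp [contractSeries]

/-- Squaring is `x ↦ x^2`, and this commutes with extracting the exponents divisible by an odd `p`.
-/
theorem heckeT_sq {p : ℕ} (hp : Odd p) (f : (ZMod 2)⟦X⟧) :
    heckeT p (f ^ 2) = heckeT p f ^ 2 := by
  have hp0 : p ≠ 0 := hp.pos.ne'
  have h2 : ∀ a b : (ZMod 2)⟦X⟧, (a + b) ^ 2 = a ^ 2 + b ^ 2 := by
    intro a b
    rw [sq_eq_expand_two, map_add, ← sq_eq_expand_two, ← sq_eq_expand_two]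
  rw [heckeT_eq hp0, heckeT_eq hp0, h2, map_pow]
  congr 1
  ext n
  rw [sq_eq_expand_two, sq_eq_expand_two, coeff_expand, contractSeries, coeff_mk, coeff_expand,
    contractSeries, coeff_mk]
  have h : 2 ∣ p * n ↔ 2 ∣ n := by
    rw [Nat.prime_two.dvd_mul, or_iff_right hp.not_two_dvd_nat]
  simp only [h]
  split_ifs with h'
  · rw [Nat.mul_div_assoc _ h']
  · rfl

/-- The recurrence for `T_5 (D ^ k)` that the modular equation gives. -/
theorem heckeT_seriesD_pow_add_six (k : ℕ) :
    heckeT 5 (seriesD ^ (k + 6)) =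
      seriesD * heckeT 5 (seriesD ^ (k + 1)) + seriesD ^ 6 * heckeT 5 (seriesD ^ k) := by
  have h5 : (5 : ℕ) ≠ 0 := by norm_num
  have h := seriesD_modular_equation
  have hc : contractSeries 5 (seriesD ^ (k + 6)) = seriesD * contractSeries 5 (seriesD ^ (k + 1)) +
      seriesD ^ 6 * contractSeries 5 (seriesD ^ k) := by
    rw [← contractSeries_expand_mul h5, ← contractSeries_expand_mul h5, ← contractSeries_add,
      map_pow]
    have h' : seriesD ^ (k + 6) = expand 5 h5 seriesD * seriesD ^ (k + 1) +
        expand 5 h5 seriesD ^ 6 * seriesD ^ k := by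
      rw [pow_add, h]
      ring
    rw [h']
  have he : expand 5 h5 (seriesD ^ (k + 6)) = seriesD * expand 5 h5 (seriesD ^ (k + 1)) +
      seriesD ^ 6 * expand 5 h5 (seriesD ^ k) := by
    simp only [map_pow]
    generalize expand 5 h5 seriesD = E at h
    generalize seriesD = D at h
    -- In characteristic 2 the modular equation also reads `E^6 = D E + D^6`; multiply by `E^k`.
    linear_combination (-E ^ k) * h - powerSeries_add_self (D * E ^ (k + 1))
  rw [heckeT_eq h5, heckeT_eq h5, heckeT_eq h5, hc, he]
  ring

/-! ### Initial values of the recurrence -/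

theorem heckeT_one : heckeT 5 (1 : (ZMod 2)⟦X⟧) = 0 := by
  have h5 : (5 : ℕ) ≠ 0 := by norm_num
  have h : contractSeries 5 1 = 1 := by
    simp [contractSeries, PowerSeries.ext_iff, coeff_one]
  rw [heckeT_eq h5, map_one, h, powerSeries_add_self]

theorem coeff_seriesD (N : ℕ) [Decidable (∃ n : ℕ, 0 < n ∧ n.Coprime 6 ∧ N = n ^ 2)] :
    coeff N seriesD = if ∃ n : ℕ, 0 < n ∧ n.Coprime 6 ∧ N = n ^ 2 then 1 else 0 := by
  rw [seriesD, coeff_mk]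
  congr

theorem heckeT_seriesD : heckeT 5 seriesD = 0 := by
  classical
  have h5 : (5 : ℕ) ≠ 0 := by norm_num
  -- If `5n = m^2` then `m = 5q` and `n = 5q^2`, so the two halves of `T_5 D` coincide and cancel.
  have h : contractSeries 5 seriesD = expand 5 h5 seriesD := by
    rw [seriesD_eq_squareSeries]
    ext n
    rw [contractSeries, coeff_mk, coeff_expand_squareSeries, coeff_squareSeries]
    congr 1
    rw [eq_iff_iff]
    constructor
    · rintro ⟨m, ⟨h0, h1⟩, h2⟩
      obtain ⟨q, rfl⟩ : 5 ∣ m := Nat.prime_five.dvd_of_dvd_pow (h2 ▸ dvd_mul_right 5 n)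
      refine ⟨q, ⟨by omega, h1.coprime_mul_left⟩, ?_⟩
      linarith
    · rintro ⟨q, ⟨h0, h1⟩, rfl⟩
      refine ⟨5 * q, ⟨by omega, Nat.Coprime.mul_left (by norm_num) h1⟩, by ring⟩
  rw [heckeT_eq h5, h, powerSeries_add_self]

theorem heckeT_seriesD_sq : heckeT 5 (seriesD ^ 2) = 0 := by
  rw [heckeT_sq (by decide), heckeT_seriesD, zero_pow two_ne_zero]

theorem heckeT_seriesD_four : heckeT 5 (seriesD ^ 4) = 0 := by
  rw [show seriesD ^ 4 = (seriesD ^ 2) ^ 2 by ring, heckeT_sq (by decide), heckeT_seriesD_sq,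
    zero_pow two_ne_zero]

theorem heckeT_seriesD_cube : heckeT 5 (seriesD ^ 3) = 0 := by
  -- The recurrence makes `T_5(D^6)`, which is the square of `T_5(D^3)`, vanish.
  have h := heckeT_seriesD_pow_add_six 0
  rw [zero_add, zero_add, pow_one, pow_zero, heckeT_seriesD, heckeT_one, mul_zero, mul_zero,
    add_zero, show seriesD ^ 6 = (seriesD ^ 3) ^ 2 by ring, heckeT_sq (by decide)] at h
  exact pow_eq_zero_iff two_ne_zero |>.1 h

theorem X_dvd_seriesD : ∃ g : (ZMod 2)⟦X⟧, seriesD = X * g ∧ coeff 0 g = 1 := by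
  classical
  have h0 : coeff 0 seriesD = 0 := by
    rw [coeff_seriesD, if_neg]
    rintro ⟨n, h, -, h'⟩
    have := pow_pos h 2
    omega
  obtain ⟨g, hg⟩ := X_dvd_iff.2 ((coeff_zero_eq_constantCoeff_apply _).symm.trans h0)
  refine ⟨g, hg, ?_⟩
  rw [← coeff_succ_X_mul 0 g, ← hg, zero_add, coeff_seriesD, if_pos ⟨1, by norm_num⟩]

theorem coeff_self_seriesD_pow (k : ℕ) : coeff k (seriesD ^ k) = 1 := by
  obtain ⟨g, hg, h0⟩ := X_dvd_seriesD
  have h := coeff_X_pow_mul (g ^ k) k 0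
  rw [coeff_zero_eq_constantCoeff_apply] at h0
  rw [zero_add] at h
  rw [hg, mul_pow, h, coeff_zero_eq_constantCoeff_apply, map_pow, h0, one_pow]

theorem coeff_seriesD_pow_of_lt {j k : ℕ} (h : j < k) : coeff j (seriesD ^ k) = 0 := by
  obtain ⟨g, hg, -⟩ := X_dvd_seriesD
  rw [hg, mul_pow]
  exact X_pow_dvd_iff.1 (dvd_mul_right _ _) j h

theorem heckeT_seriesD_five : heckeT 5 (seriesD ^ 5) = seriesD := by
  -- This becomes `T_5(D^5)^2 = D T_5(D^5)`; the factor `T_5(D^5)` can be cancelled because its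
  -- coefficient of `x` is 1.
  have h := heckeT_seriesD_pow_add_six 4
  rw [heckeT_seriesD_four, mul_zero, add_zero, show seriesD ^ (4 + 6) = (seriesD ^ 5) ^ 2 by ring,
    heckeT_sq (by decide), sq] at h
  refine mul_right_cancel₀ (fun h0 => ?_) h
  have h1 : coeff 1 (heckeT 5 (seriesD ^ (4 + 1))) = 1 := by
    rw [heckeT_eq (by norm_num), map_add, coeff_expand_of_not_dvd _ _ _ (by norm_num), add_zero,
      contractSeries, coeff_mk, mul_one, coeff_self_seriesD_pow]
  rw [h0] at h1
  simp at h1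

/-! ### Spans of powers of `D` -/

/-- `D^k` has order exactly `k`, so the least exponent in a relation cannot cancel. -/
theorem linearIndependent_seriesD_pow : LinearIndependent (ZMod 2) fun k : ℕ => seriesD ^ k := by
  rw [linearIndependent_iff']
  intro s c hs
  by_contra! hc
  have hne : (s.filter fun i => c i ≠ 0).Nonempty := by
    obtain ⟨i, hi, hi'⟩ := hc
    exact ⟨i, Finset.mem_filter.2 ⟨hi, hi'⟩⟩
  have hm := Finset.mem_filter.1 (Finset.min'_mem _ hne)
  set m := (s.filter fun i => c i ≠ 0).min' hne
  have h := congrArg (coeff m) hs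
  rw [map_sum, Finset.sum_eq_single_of_mem m hm.1, map_smul, coeff_self_seriesD_pow, map_zero,
    smul_eq_mul, mul_one] at h
  · exact hm.2 h
  · intro i hi him
    by_cases hci : c i = 0
    · rw [hci, zero_smul, map_zero]
    · have : m ≤ i := Finset.min'_le _ i (Finset.mem_filter.2 ⟨hi, hci⟩)
      rw [map_smul, coeff_seriesD_pow_of_lt (lt_of_le_of_ne this him.symm), smul_zero]

/-- The span of the powers of `D` with exponent in `S`. -/
def powSpan (S : Set ℕ) : Submodule (ZMod 2) (ZMod 2)⟦X⟧ :=
  Submodule.span (ZMod 2) ((fun k => seriesD ^ k) '' S)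

theorem seriesD_pow_mem_powSpan {S : Set ℕ} {k : ℕ} (hk : k ∈ S) : seriesD ^ k ∈ powSpan S :=
  Submodule.subset_span ⟨k, hk, rfl⟩

theorem powSpan_mono {S S' : Set ℕ} (h : S ⊆ S') : powSpan S ≤ powSpan S' :=
  Submodule.span_mono (Set.image_mono h)

theorem seriesD_pow_mul_mem_powSpan {S S' : Set ℕ} (a : ℕ) (h : ∀ j ∈ S, a + j ∈ S')
    {f : (ZMod 2)⟦X⟧} (hf : f ∈ powSpan S) : seriesD ^ a * f ∈ powSpan S' := by
  induction hf using Submodule.span_induction with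
  | mem f hf =>
    obtain ⟨j, hj, rfl⟩ := hf
    simp only [← pow_add]
    exact seriesD_pow_mem_powSpan (h j hj)
  | zero => simp
  | add f g _ _ hf hg => rw [mul_add]; exact add_mem hf hg
  | smul c f _ hf => rw [mul_smul_comm]; exact Submodule.smul_mem _ _ hf

theorem exists_finset_of_mem_powSpan {S : Set ℕ} {f : (ZMod 2)⟦X⟧} (hf : f ∈ powSpan S) :
    ∃ t : Finset ℕ, (∀ j ∈ t, j ∈ S) ∧ f = ∑ j ∈ t, seriesD ^ j := by
  obtain ⟨l, hl, rfl⟩ := (Finsupp.mem_span_image_iff_linearCombination _).1 hf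
  refine ⟨l.support, fun j hj => hl hj, ?_⟩
  rw [Finsupp.linearCombination_apply, Finsupp.sum]
  refine Finset.sum_congr rfl fun j hj => ?_
  have : ∀ c : ZMod 2, c ≠ 0 → c = 1 := by decide
  rw [this _ (Finsupp.mem_support_iff.1 hj), one_smul]

theorem seriesD_pow_notMem_powSpan {S : Set ℕ} {k : ℕ} (hk : k ∉ S) :
    seriesD ^ k ∉ powSpan S :=
  linearIndependent_seriesD_pow.notMem_span_image hk

theorem spaceW1_eq : spaceW1 = powSpan {j | j % 6 = 1} := by
  rw [spaceW1, powSpan]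
  congr 1
  ext f
  simp only [Set.mem_ofPred_eq, Set.mem_image, Nat.ModEq]
  constructor
  · rintro ⟨k, h0, h1, rfl⟩
    exact ⟨k, h1, rfl⟩
  · rintro ⟨k, h1, rfl⟩
    exact ⟨k, by omega, h1, rfl⟩

theorem spaceW5_eq : spaceW5 = powSpan {j | j % 6 = 5} := by
  rw [spaceW5, powSpan]
  congr 1
  ext f
  simp only [Set.mem_ofPred_eq, Set.mem_image, Nat.ModEq]
  constructor
  · rintro ⟨k, h0, h1, rfl⟩
    exact ⟨k, h1, rfl⟩
  · rintro ⟨k, h1, rfl⟩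
    exact ⟨k, by omega, h1, rfl⟩

/-! ### Triangularity and bijectivity -/

theorem heckeT_seriesD_pow_mem (k : ℕ) :
    heckeT 5 (seriesD ^ k) ∈ powSpan {j | j % 6 = 5 * k % 6 ∧ j + 4 ≤ k} := by
  induction k using Nat.strong_induction_on with
  | _ k ih =>
    by_cases hk : k < 6
    · interval_cases k
      · rw [pow_zero, heckeT_one]; exact zero_mem _
      · rw [pow_one, heckeT_seriesD]; exact zero_mem _
      · rw [heckeT_seriesD_sq]; exact zero_mem _
      · rw [heckeT_seriesD_cube]; exact zero_mem _
      · rw [heckeT_seriesD_four]; exact zero_mem _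
      · rw [heckeT_seriesD_five, ← pow_one seriesD]
        exact seriesD_pow_mem_powSpan (by simp)
    · obtain ⟨n, rfl⟩ := Nat.exists_eq_add_of_le' (not_lt.1 hk)
      rw [heckeT_seriesD_pow_add_six]
      refine add_mem ?_ (seriesD_pow_mul_mem_powSpan 6 ?_ (ih n (by omega)))
      · have := seriesD_pow_mul_mem_powSpan (S' := {j | j % 6 = 5 * (n + 6) % 6 ∧ j + 4 ≤ n + 6})
          1 ?_ (ih (n + 1) (by omega))
        · rwa [pow_one] at this
        · simp only [Set.mem_ofPred_eq]
          omega
      · simp only [Set.mem_ofPred_eq]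
        omega

theorem heckeT_seriesD_pow_add_leading_mem (m : ℕ) :
    heckeT 5 (seriesD ^ (6 * m + 5)) - seriesD ^ (6 * m + 1) ∈
      powSpan {j | j % 6 = 1 ∧ j < 6 * m + 1} := by
  induction m with
  | zero => simp [heckeT_seriesD_five]
  | succ m ih =>
    -- In the recurrence only `D^6 T_5(D^(6m+5))` reaches the leading exponent `6m+7`; the powers in
    -- `D T_5(D^(6m+6))` have exponent at most `6m+3`.
    have h1 := seriesD_pow_mul_mem_powSpan (S' := {j | j % 6 = 1 ∧ j < 6 * (m + 1) + 1})
      1 ?_ (heckeT_seriesD_pow_mem (6 * m + 5 + 1))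
    · have h2 := seriesD_pow_mul_mem_powSpan (S' := {j | j % 6 = 1 ∧ j < 6 * (m + 1) + 1}) 6 ?_ ih
      · convert add_mem h1 h2 using 1
        rw [show 6 * (m + 1) + 5 = 6 * m + 5 + 6 by ring, heckeT_seriesD_pow_add_six]
        ring
      · simp only [Set.mem_ofPred_eq]
        omega
    · simp only [Set.mem_ofPred_eq]
      omega

theorem heckeT_mapsTo : ∀ f ∈ spaceW5, heckeT 5 f ∈ spaceW1 := by
  intro f hf
  rw [spaceW5_eq] at hf
  rw [spaceW1_eq]
  obtain ⟨t, ht, rfl⟩ := exists_finset_of_mem_powSpan hf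
  rw [map_sum]
  refine sum_mem fun j hj => powSpan_mono ?_ (heckeT_seriesD_pow_mem j)
  have := ht j hj
  simp only [Set.mem_ofPred_eq] at this
  intro i
  simp only [Set.mem_ofPred_eq]
  omega

theorem heckeT_eq_zero_of_mem_spaceW5 {f : (ZMod 2)⟦X⟧} (hf : f ∈ spaceW5)
    (h : heckeT 5 f = 0) : f = 0 := by
  rw [spaceW5_eq] at hf
  obtain ⟨t, ht, rfl⟩ := exists_finset_of_mem_powSpan hf
  rcases t.eq_empty_or_nonempty with rfl | hne
  · exact Finset.sum_empty
  exfalso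
  obtain ⟨M, hM⟩ : ∃ M, t.max' hne = 6 * M + 5 :=
    ⟨t.max' hne / 6, by have := ht _ (t.max'_mem hne); simp only [Set.mem_ofPred_eq] at this; omega⟩
  have hmem : 6 * M + 5 ∈ t := hM ▸ t.max'_mem hne
  -- The image of the top power contributes `D^(6M+1)`, and all other terms lie in the span of lower
  -- powers, so a zero image would contradict independence.
  refine seriesD_pow_notMem_powSpan (S := {j | j % 6 = 1 ∧ j < 6 * M + 1}) (k := 6 * M + 1)
    (by simp) ?_
  have hrest : ∑ j ∈ t.erase (6 * M + 5), heckeT 5 (seriesD ^ j) ∈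
      powSpan {j | j % 6 = 1 ∧ j < 6 * M + 1} := by
    refine sum_mem fun j hj => powSpan_mono ?_ (heckeT_seriesD_pow_mem j)
    obtain ⟨hj1, hj2⟩ := Finset.mem_erase.1 hj
    have h1 := ht j hj2
    have h2 := t.le_max' j hj2
    simp only [Set.mem_ofPred_eq] at h1
    intro i
    simp only [Set.mem_ofPred_eq]
    omega
  rw [map_sum, ← Finset.add_sum_erase t _ hmem] at h
  rw [← Submodule.neg_mem_iff]
  convert add_mem (heckeT_seriesD_pow_add_leading_mem M) hrest using 1
  linear_combination -h

theorem heckeT_surjOn {f : (ZMod 2)⟦X⟧} (hf : f ∈ spaceW1) : ∃ g ∈ spaceW5, heckeT 5 g = f := by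
  have key : ∀ j : ℕ, j % 6 = 1 → seriesD ^ j ∈ spaceW5.map (heckeT 5) := by
    intro j
    induction j using Nat.strong_induction_on with
    | _ j ih =>
      intro hj
      obtain ⟨m, rfl⟩ : ∃ m, j = 6 * m + 1 := ⟨j / 6, by omega⟩
      obtain ⟨t, ht, h⟩ := exists_finset_of_mem_powSpan (heckeT_seriesD_pow_add_leading_mem m)
      -- Back substitution: `D^(6m+1)` is the image of `D^(6m+5)` minus lower powers, already known
      -- to be images.
      rw [show seriesD ^ (6 * m + 1) =
        heckeT 5 (seriesD ^ (6 * m + 5)) - ∑ j ∈ t, seriesD ^ j by rw [← h]; ring]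
      refine sub_mem (Submodule.mem_map_of_mem ?_) (sum_mem fun i hi => ih i (ht i hi).2 (ht i hi).1)
      rw [spaceW5_eq]
      exact seriesD_pow_mem_powSpan (by simp only [Set.mem_ofPred_eq]; omega)
  rw [spaceW1_eq] at hf
  obtain ⟨t, ht, rfl⟩ := exists_finset_of_mem_powSpan hf
  exact Submodule.mem_map.1 (sum_mem fun j hj => key j (ht j hj))

end

theorem theorem4p20 :
    (∀ m : ℕ, ∃ s : Finset ℕ, (∀ r ∈ s, r < m) ∧
      heckeT 5 (seriesD ^ (6 * m + 5)) =
        seriesD ^ (6 * m + 1) + ∑ r ∈ s, seriesD ^ (6 * r + 1)) ∧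
    Set.BijOn (heckeT 5) (spaceW5 : Set (PowerSeries (ZMod 2)))
      (spaceW1 : Set (PowerSeries (ZMod 2))) := by
  refine ⟨fun m => ?_, heckeT_mapsTo, ?_, fun f hf => heckeT_surjOn hf⟩
  · obtain ⟨t, ht, h⟩ := exists_finset_of_mem_powSpan (heckeT_seriesD_pow_add_leading_mem m)
    simp only [Set.mem_ofPred_eq] at ht
    refine ⟨t.image (· / 6), ?_, ?_⟩
    · intro r hr
      obtain ⟨j, hj, rfl⟩ := Finset.mem_image.1 hr
      have := ht j hj
      omega
    · rw [Finset.sum_image, ← sub_eq_iff_eq_add', h]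
      · refine Finset.sum_congr rfl fun j hj => ?_
        have := ht j hj
        congr 1
        omega
      · intro i hi j hj hij
        have h1 := ht i hi
        have h2 := ht j hj
        simp only at hij
        omega
  · intro f hf g hg h
    rw [← sub_eq_zero]
    refine heckeT_eq_zero_of_mem_spaceW5 (sub_mem hf hg) ?_
    rw [map_sub, h, sub_self]
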